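/- Let $\mathbb{D}=\{z\in\mathbb{C}:|z|<1\}$ and $\mathbb{T}=\{z\in\mathbb{C}:|z|=1\}$. For an increasing sequence $\rho=(r_n)_n$ in $[0,1)$ with $r_n\to 1$, let $\mathcal{U}_A(\mathbb{D},\rho)$ be the set of all holomorphic functions $f$ on $\mathbb{D}$ such that for every compact set $K\subset\mathbb{T}$ with $K\neq\mathbb{T}$ and every continuous function $\varphi:K\to\mathbb{C}$ there is a strictly increasing sequence $(n_k)_k$ in $\mathbb{N}$ with $\sup_{\zeta\in K}|f(r_{n_k}\zeta)-\varphi(\zeta)|\to 0$ as $k\to\infty$. Let $\mathcal{U}_A(\mathbb{D})$, the class of Abel universal functions, be the union of the sets $\mathcal{U}_A(\mathbb{D},\rho)$ over all such $\rho$. A number $\alpha\in\mathbb{C}$ is an asymptotic value of $f$ if there is a continuous path $\gamma:[0,1)\to\mathbb{D}$ with $|\gamma(t)|\to 1$ and $f(\gamma(t))\to\alpha$ as $t\to 1$. Corollary. Let $\mathcal{U}$ be $\mathcal{U}_A(\mathbb{D},\rho)$ for an arbitrary sequence $\rho$ as above, or $\mathcal{U}=\mathcal{U}_A(\mathbb{D})$.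 (1) If $f\in\mathcal{U}$, then $e^f\in\mathcal{U}$. Moreover, $\mathcal{U}$ contains a function without zeros in $\mathbb{D}$. (2) If $f\in\mathcal{U}$ has no zeros in $\mathbb{D}$, then $\alpha+1/f\in\mathcal{U}$ for every $\alpha\in\mathbb{C}$. Moreover, for every $\alpha\in\mathbb{C}$ there is a function in $\mathcal{U}$ that has $\alpha$ as an asymptotic value. -/

import Mathlib

namespace AbelUniv

open Filter Topology

/-- An increasing sequence of radii in `[0,1)` that tends to `1`. -/
structure IsRadii (r : ℕ → ℝ) : Prop where
  mem : ∀ n, r n ∈ Set.Ico (0 : ℝ) 1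
  mono : Monotone r
  tendsto : Tendsto r atTop (𝓝 1)

/-- The class of Abel universal functions with respect to the radii `r`: functions `f` holomorphic
on the unit disc (only the values of `f : ℂ → ℂ` on the disc matter) such that, for every compact
proper subset `K` of the unit circle and every continuous `φ` on `K`, some subsequence of the
dilates `ζ ↦ f (r n * ζ)` converges to `φ` uniformly on `K`. -/
def UnivWith (r : ℕ → ℝ) : Set (ℂ → ℂ) :=
  {f | DifferentiableOn ℂ f (Metric.ball 0 1) ∧
    ∀ K : Set ℂ, K ⊆ Metric.sphere 0 1 → IsCompact K → K ≠ Metric.sphere 0 1 →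
      ∀ φ : ℂ → ℂ, ContinuousOn φ K →
        ∃ n : ℕ → ℕ, StrictMono n ∧
          TendstoUniformlyOn (fun (k : ℕ) (ζ : ℂ) => f ((r (n k) : ℂ) * ζ)) φ atTop K}

/-- The class of all Abel universal functions. -/
def Univ : Set (ℂ → ℂ) :=
  {f | ∃ r : ℕ → ℝ, IsRadii r ∧ f ∈ UnivWith r}

/-- `f` has no zeros in the unit disc. -/
def ZeroFree (f : ℂ → ℂ) : Prop :=
  ∀ z ∈ Metric.ball (0 : ℂ) 1, f z ≠ 0

/-- `α ∈ ℂ` is an asymptotic value of `f`: there is a path `γ : [0,1) → 𝔻` with `|γ t| → 1` and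
`f (γ t) → α` as `t → 1`. -/
def HasAsymptoticValue (f : ℂ → ℂ) (α : ℂ) : Prop :=
  ∃ γ : ℝ → ℂ, ContinuousOn γ (Set.Ico 0 1) ∧
    Set.MapsTo γ (Set.Ico 0 1) (Metric.ball 0 1) ∧
    Tendsto (fun t => ‖γ t‖) (𝓝[<] 1) (𝓝 1) ∧
    Tendsto (fun t => f (γ t)) (𝓝[<] 1) (𝓝 α)

end AbelUniv

namespace AbelUniv

open Filter Topology

/-! On a proper compact part `K` of the circle, every continuous function is a uniform limit of
exponentials `e^g` with `g` continuous (`exists_exp_near`). If a dilate of `f` is near `g`, then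
that of `e^f` is near `e^g`; if it is near `e^{-g}`, then that of `1/f` is near `e^g`. This gives
both closure properties. Universal functions exist by summing polynomial corrections, each tiny on a
disc and prescribed on part of a larger circle (`exists_polynomial_small_on_disc_near_on_arc`);
their exponentials are zero-free. For asymptotic values, the maximum principle shows that `f` is
unbounded on every component of `{M < |f|}` with `M ≥ 1` (`exists_lt_norm_of_component`). Joining
points of ever higher level sets gives a curve along which `f → ∞`, so `α + 1/f → α` there. -/

/-! ### Polynomial approximation on a disc together with part of a larger circle. -/

theorem isPreconnected_polar {I : Set ℝ} (hI : IsPreconnected I) (hI0 : ∀ t ∈ I, 0 < t) :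
    IsPreconnected {z : ℂ | ‖z‖ ∈ I} := by
  have h : {z : ℂ | ‖z‖ ∈ I} =
      (fun p : ℝ × ℝ => (p.1 : ℂ) * Complex.exp (p.2 * Complex.I)) '' (I ×ˢ Set.univ) := by
    ext z
    simp only [Set.mem_ofPred_eq, Set.mem_image, Set.mem_prod, Set.mem_univ, and_true, Prod.exists]
    constructor
    · intro hz
      exact ⟨‖z‖, Complex.arg z, hz, Complex.norm_mul_exp_arg_mul_I z⟩
    · rintro ⟨t, θ, ht, rfl⟩
      simpa [Complex.norm_exp_ofReal_mul_I, abs_of_pos (hI0 t ht)] using ht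
  rw [h]
  exact (hI.prod isPreconnected_univ).image _ (by fun_prop)

/-- The complement of a closed disc together with a proper part of a larger concentric circle is
connected. -/
theorem isPreconnected_compl_disc_union_arc {s R : ℝ} (hs : 0 ≤ s) (hsR : s < R) {K : Set ℂ}
    (hK : K ⊆ Metric.sphere 0 1) (hK' : K ≠ Metric.sphere 0 1) :
    IsPreconnected (Metric.closedBall (0 : ℂ) s ∪ (fun ζ => (R : ℂ) * ζ) '' K)ᶜ := by
  have hR : 0 < R := hs.trans_lt hsR
  obtain ⟨ζ₀, hζ₀, hζ₀K⟩ := Set.exists_of_ssubset (hK.ssubset_of_ne hK')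
  set A : Set ℂ := {z : ℂ | ‖z‖ ∈ Set.Ioi R} with hA
  have hApre : IsPreconnected A :=
    isPreconnected_polar isPreconnected_Ioi fun t ht => hR.trans ht
  set ray : ℂ → Set ℂ := fun ζ => (fun t : ℝ => (t : ℂ) * ζ) '' Set.Ioi s with hray
  have hraypre : ∀ ζ, IsPreconnected (ray ζ) := fun ζ =>
    isPreconnected_Ioi.image _ (by fun_prop)
  have hAsub : A ⊆ (Metric.closedBall (0 : ℂ) s ∪ (fun ζ => (R : ℂ) * ζ) '' K)ᶜ := by
    rintro z hz (h | ⟨ζ, hζ, rfl⟩)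
    · have h1 : R < ‖z‖ := hz
      have h2 : ‖z‖ ≤ s := by simpa using h
      linarith
    · have h1 : R < ‖(R : ℂ) * ζ‖ := hz
      have h2 : ‖ζ‖ = 1 := by simpa using hK hζ
      simp [h2, abs_of_pos hR] at h1
  have hraysub : ∀ ζ ∈ Metric.sphere (0 : ℂ) 1, ζ ∉ K →
      ray ζ ⊆ (Metric.closedBall (0 : ℂ) s ∪ (fun ζ => (R : ℂ) * ζ) '' K)ᶜ := by
    rintro ζ hζ hζK _ ⟨t, ht, rfl⟩ h
    have ht0 : 0 < t := hs.trans_lt ht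
    have hζ1 : ‖ζ‖ = 1 := by simpa using hζ
    rcases h with h | ⟨ξ, hξ, h⟩
    · have h2 : |t| ≤ s := by simpa [hζ1] using h
      rw [abs_of_pos ht0] at h2
      exact absurd ht (not_lt.mpr h2)
    · have hξ1 : ‖ξ‖ = 1 := by simpa using hK hξ
      have h3 := congrArg norm h
      simp only [norm_mul, Complex.norm_real, hξ1, hζ1, mul_one, Real.norm_eq_abs,
        abs_of_pos ht0, abs_of_pos hR] at h3
      subst h3
      have : ξ = ζ := mul_left_cancel₀ (by exact_mod_cast hR.ne') h
      exact hζK (this ▸ hξ)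
  have hmeet : ∀ ζ ∈ Metric.sphere (0 : ℂ) 1, ((2 * R : ℝ) : ℂ) * ζ ∈ A ∩ ray ζ := by
    intro ζ hζ
    have hζ1 : ‖ζ‖ = 1 := by simpa using hζ
    refine ⟨?_, 2 * R, ?_, rfl⟩
    · simp only [hA, Set.mem_ofPred_eq, norm_mul, Complex.norm_real, hζ1, mul_one,
        Complex.ofReal_mul, Complex.ofReal_ofNat, Complex.norm_ofNat,
        Real.norm_eq_abs, abs_of_pos hR, Set.mem_Ioi]
      linarith
    · simp only [Set.mem_Ioi]; linarith
  have hunit : ∀ ζ ∈ Metric.sphere (0 : ℂ) 1, IsPreconnected (A ∪ ray ζ) := fun ζ hζ =>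
    hApre.union' ⟨_, hmeet ζ hζ⟩ (hraypre ζ)
  refine isPreconnected_of_forall (((2 * R : ℝ) : ℂ) * ζ₀) fun y hy => ?_
  have hys : s < ‖y‖ := by
    by_contra h
    exact hy (Or.inl (by simpa using h))
  have hy0 : 0 < ‖y‖ := hs.trans_lt hys
  -- Below radius `R`, follow the circle through `y` to the ray in the gap direction `ζ₀`; at radius
  -- `R`, `y` lies in a gap itself and its own ray leads out; beyond `R`, `y` is already in `A`.
  rcases lt_trichotomy ‖y‖ R with h | h | h
  · set B : Set ℂ := {z : ℂ | ‖z‖ ∈ ({‖y‖} : Set ℝ)} with hB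
    have hBpre : IsPreconnected B :=
      isPreconnected_polar isPreconnected_singleton (by rintro t rfl; exact hy0)
    refine ⟨(A ∪ ray ζ₀) ∪ B, ?_, Or.inl (Or.inl (hmeet ζ₀ hζ₀).1), Or.inr rfl, ?_⟩
    · refine Set.union_subset (Set.union_subset hAsub (hraysub ζ₀ hζ₀ hζ₀K)) ?_
      rintro z (hz : ‖z‖ = ‖y‖) (h' | ⟨ζ, hζ, rfl⟩)
      · have h2 : ‖z‖ ≤ s := by simpa using h'
        linarith
      · have h2 : ‖ζ‖ = 1 := by simpa using hK hζ
        simp only [norm_mul, Complex.norm_real, Real.norm_eq_abs, abs_of_pos hR, h2, mul_one] at hz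
        linarith
    · refine (hunit ζ₀ hζ₀).union' ⟨(‖y‖ : ℂ) * ζ₀, Or.inr ⟨‖y‖, hys, rfl⟩, ?_⟩ hBpre
      have hζ1 : ‖ζ₀‖ = 1 := by simpa using hζ₀
      simp [hB, hζ1]
  · have hR0 : (R : ℂ) ≠ 0 := by exact_mod_cast hR.ne'
    have hyR : y = (R : ℂ) * (y / R) := by field_simp
    have hζ : y / R ∈ Metric.sphere (0 : ℂ) 1 := by
      simp [h, abs_of_pos hR, hR.ne']
    have hζK : y / R ∉ K := fun hmem => hy (Or.inr ⟨_, hmem, hyR.symm⟩)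
    refine ⟨A ∪ ray (y / R), Set.union_subset hAsub (hraysub _ hζ hζK), Or.inl ?_,
      Or.inr ⟨R, hsR, hyR.symm⟩, hunit _ hζ⟩
    exact (hmeet ζ₀ hζ₀).1
  · exact ⟨A, hAsub, (hmeet ζ₀ hζ₀).1, h, hApre⟩

/-- On a compact set with connected complement, the function `1 / (z ^ N - a)` is a uniform limit
of polynomials as soon as `a` is not an `N`-th power of a point of the set. -/
theorem exists_mem_closure_polynomial_inv {X : Set ℂ} [CompactSpace X]
    (hX : IsPreconnected Xᶜ) {N : ℕ} (hN : 0 < N) {a : ℂ} (ha : ∀ z ∈ X, z ^ N ≠ a) :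
    ∃ u ∈ (polynomialFunctions X).topologicalClosure, ∀ z : X, u z * ((z : ℂ) ^ N - a) = 1 := by
  set S := (polynomialFunctions X).topologicalClosure with hS
  have hSc : IsClosed (S : Set C(X, ℂ)) := Subalgebra.isClosed_topologicalClosure _
  let x : S := ⟨ContinuousMap.restrict X (.id ℂ),
    Subalgebra.le_topologicalClosure _ ⟨Polynomial.X, Algebra.mem_top,
      Polynomial.toContinuousMapOn_X_eq_restrict_id X⟩⟩
  have hrange : spectrum ℂ (x : C(X, ℂ)) = X := by
    rw [ContinuousMap.spectrum_eq_range]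
    ext z
    simp [x]
  -- Passing to a closed subalgebra can enlarge a spectrum only by filling holes, and `X` has none.
  have hspec : spectrum ℂ x = X := by
    rw [Subalgebra.spectrum_eq_of_isPreconnected_compl S x (by rwa [hrange]), hrange]
  have hpow : a ∉ spectrum ℂ (x ^ N) := by
    rw [spectrum.map_pow_of_pos x hN, hspec]
    rintro ⟨z, hz, h⟩
    exact ha z hz h
  rw [spectrum.notMem_iff] at hpow
  obtain ⟨v, hv⟩ := hpow.exists_left_inv
  refine ⟨-(v : C(X, ℂ)), S.neg_mem v.2, fun z => ?_⟩
  have h := congrArg (fun w : S => (w : C(X, ℂ)) z) hv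
  have h' : (v : C(X, ℂ)) z * (a - (z : ℂ) ^ N) = 1 := by
    simpa [x, Algebra.algebraMap_eq_smul_one] using h
  rw [ContinuousMap.neg_apply, ← h']
  ring

/-- On the union `X` of a disc and a set of points of modulus `R`, the function that is `0` on the
disc and `z ^ (-k)` elsewhere is a uniform limit of polynomials. -/
theorem mem_closure_polynomial_of_mul_pow {s R : ℝ} (hs : 0 < s) (hsR : s < R) {X : Set ℂ}
    [CompactSpace X] (hX : IsPreconnected Xᶜ) (hXm : ∀ z ∈ X, ‖z‖ ≤ s ∨ ‖z‖ = R) (k : ℕ)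
    (h : C(X, ℂ)) (h0 : ∀ z : X, ‖(z : ℂ)‖ ≤ s → h z = 0)
    (h1 : ∀ z : X, ‖(z : ℂ)‖ = R → h z * (z : ℂ) ^ k = 1) :
    h ∈ (polynomialFunctions X).topologicalClosure := by
  set S := (polynomialFunctions X).topologicalClosure with hS
  have hSc : IsClosed (S : Set C(X, ℂ)) := Subalgebra.isClosed_topologicalClosure _
  have hR : 0 < R := hs.trans hsR
  let x : C(X, ℂ) := ContinuousMap.restrict X (.id ℂ)
  have hx : x ∈ S := Subalgebra.le_topologicalClosure _ ⟨Polynomial.X, Algebra.mem_top,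
      Polynomial.toContinuousMapOn_X_eq_restrict_id X⟩
  -- The approximants are `z^(N-k) / (z^N - c^N)` with `N` large. The geometric mean gives `c/s =
  -- R/c = q`, so the errors on both pieces are governed by `1 / (q^N - 1)`.
  obtain ⟨c, hc⟩ : ∃ c : ℝ, c = Real.sqrt (s * R) := ⟨_, rfl⟩
  have hc2 : c ^ 2 = s * R := by rw [hc, Real.sq_sqrt (by positivity)]
  have hc0 : 0 < c := by rw [hc]; positivity
  have hsc : s < c := by nlinarith
  have hcR : c < R := by nlinarith
  set q : ℝ := c / s with hq
  have hq1 : 1 < q := (one_lt_div hs).mpr hsc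
  have hcs : c = s * q := by rw [hq]; field_simp
  have hRq : R = c * q := by
    rw [hq]; field_simp; nlinarith
  set M : ℝ := max ((s ^ k)⁻¹) ((R ^ k)⁻¹) with hM
  have hM0 : 0 < M := lt_max_of_lt_left (by positivity)
  have hlim : Tendsto (fun N : ℕ => M / (q ^ N - 1)) atTop (𝓝 0) :=
    Tendsto.div_atTop tendsto_const_nhds
      (tendsto_atTop_add_const_right _ _ (tendsto_pow_atTop_atTop_of_one_lt hq1))
  rw [← SetLike.mem_coe, ← hSc.closure_eq, Metric.mem_closure_iff]
  intro ε hε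
  obtain ⟨N, hNε, hNk⟩ := ((hlim.eventually (gt_mem_nhds hε)).and
    (eventually_ge_atTop (k + 1))).exists
  have hN : 0 < N := by omega
  have hqN : 1 < q ^ N := one_lt_pow₀ hq1 hN.ne'
  have hqN1 : 0 < q ^ N - 1 := by linarith
  obtain ⟨u, hu, huz⟩ := exists_mem_closure_polynomial_inv hX hN (a := (c : ℂ) ^ N) (by
    intro z hz hzc
    have h3 := congrArg norm hzc
    rw [norm_pow, norm_pow, Complex.norm_real, Real.norm_eq_abs, abs_of_pos hc0] at h3
    have h4 := (pow_left_inj₀ (norm_nonneg z) hc0.le hN.ne').mp h3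
    rcases hXm z hz with h5 | h5 <;> linarith)
  refine ⟨x ^ (N - k) * u, S.mul_mem (S.pow_mem hx _) hu, ?_⟩
  refine lt_of_le_of_lt ?_ hNε
  rw [ContinuousMap.dist_le (by positivity)]
  intro z
  have hzu := huz z
  have hxz : (x ^ (N - k) * u) z = (z : ℂ) ^ (N - k) * u z := by simp [x]
  rw [hxz]
  have hNk' : N - k + k = N := by omega
  rcases hXm z z.2 with hz | hz
  · rw [h0 z hz, dist_zero_left, norm_mul, norm_pow]
    have h6 : c ^ N - s ^ N ≤ ‖(z : ℂ) ^ N - (c : ℂ) ^ N‖ := by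
      have h7 := norm_sub_norm_le ((c : ℂ) ^ N) ((z : ℂ) ^ N)
      rw [norm_sub_rev, norm_pow, norm_pow, Complex.norm_real, Real.norm_eq_abs,
        abs_of_pos hc0] at h7
      have := pow_le_pow_left₀ (norm_nonneg (z : ℂ)) hz N
      linarith
    have h8 : c ^ N - s ^ N = s ^ N * (q ^ N - 1) := by rw [hcs]; ring
    have h9 : ‖u z‖ * ‖(z : ℂ) ^ N - (c : ℂ) ^ N‖ = 1 := by rw [← norm_mul, hzu, norm_one]
    have h10 : ‖u z‖ * (s ^ N * (q ^ N - 1)) ≤ 1 := by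
      rw [← h8, ← h9]; gcongr
    have h11 : ‖u z‖ ≤ 1 / (s ^ N * (q ^ N - 1)) := by
      rwa [le_div_iff₀ (by positivity)]
    calc ‖(z : ℂ)‖ ^ (N - k) * ‖u z‖ ≤ s ^ (N - k) * (1 / (s ^ N * (q ^ N - 1))) := by gcongr
      _ = (s ^ k)⁻¹ / (q ^ N - 1) := by
          have : s ^ N = s ^ (N - k) * s ^ k := by rw [← pow_add, hNk']
          rw [this]; field_simp
      _ ≤ M / (q ^ N - 1) := by gcongr; exact le_max_left _ _
  · have hz0 : (z : ℂ) ≠ 0 := by rw [← norm_pos_iff, hz]; exact hR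
    have h6 : R ^ N - c ^ N ≤ ‖(z : ℂ) ^ N - (c : ℂ) ^ N‖ := by
      have h7 := norm_sub_norm_le ((z : ℂ) ^ N) ((c : ℂ) ^ N)
      rwa [norm_pow, norm_pow, Complex.norm_real, Real.norm_eq_abs, abs_of_pos hc0, hz] at h7
    have h8 : R ^ N - c ^ N = c ^ N * (q ^ N - 1) := by rw [hRq]; ring
    have h9 : ‖u z‖ * ‖(z : ℂ) ^ N - (c : ℂ) ^ N‖ = 1 := by rw [← norm_mul, hzu, norm_one]
    have h10 : ‖u z‖ * (c ^ N * (q ^ N - 1)) ≤ 1 := by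
      rw [← h8, ← h9]; gcongr
    have h11 : ‖u z‖ ≤ 1 / (c ^ N * (q ^ N - 1)) := by
      rwa [le_div_iff₀ (by positivity)]
    have h12 : (h z - (z : ℂ) ^ (N - k) * u z) * (z : ℂ) ^ k = -((c : ℂ) ^ N * u z) := by
      rw [sub_mul, h1 z hz]
      have : (z : ℂ) ^ (N - k) * u z * (z : ℂ) ^ k = (z : ℂ) ^ N * u z := by
        rw [mul_right_comm, ← pow_add, hNk']
      rw [this]
      linear_combination -hzu
    have h13 := congrArg norm h12
    rw [norm_mul, norm_pow, hz, norm_neg, norm_mul, norm_pow, Complex.norm_real,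
      Real.norm_eq_abs, abs_of_pos hc0] at h13
    rw [dist_eq_norm]
    calc ‖h z - (z : ℂ) ^ (N - k) * u z‖ = c ^ N * ‖u z‖ / R ^ k := by
          rw [← h13]; field_simp
      _ ≤ c ^ N * (1 / (c ^ N * (q ^ N - 1))) / R ^ k := by gcongr
      _ = (R ^ k)⁻¹ / (q ^ N - 1) := by field_simp
      _ ≤ M / (q ^ N - 1) := by gcongr; exact le_max_right _ _

/-- A continuous function on a proper compact part of a circle is uniformly approximable by
polynomials that are uniformly small on a smaller concentric disc. -/
theorem exists_polynomial_small_on_disc_near_on_arc {s R : ℝ} (hs : 0 < s) (hsR : s < R)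
    {K : Set ℂ} (hK : K ⊆ Metric.sphere 0 1) (hKc : IsCompact K) (hK' : K ≠ Metric.sphere 0 1)
    {φ : ℂ → ℂ} (hφ : Continuous φ) {ε : ℝ} (hε : 0 < ε) :
    ∃ P : Polynomial ℂ, (∀ z : ℂ, ‖z‖ ≤ s → ‖P.eval z‖ < ε) ∧
      ∀ ζ ∈ K, ‖P.eval ((R : ℂ) * ζ) - φ ζ‖ < ε := by
  have hR : 0 < R := hs.trans hsR
  have hR0 : (R : ℂ) ≠ 0 := by exact_mod_cast hR.ne'
  set X : Set ℂ := Metric.closedBall (0 : ℂ) s ∪ (fun ζ => (R : ℂ) * ζ) '' K with hXdef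
  have hXc : IsCompact X := (isCompact_closedBall _ _).union (hKc.image (by fun_prop))
  have : CompactSpace X := isCompact_iff_compactSpace.mp hXc
  have hX : IsPreconnected Xᶜ := isPreconnected_compl_disc_union_arc hs.le hsR hK hK'
  have hXm : ∀ z ∈ X, ‖z‖ ≤ s ∨ ‖z‖ = R := by
    rintro z (h | ⟨ζ, hζ, rfl⟩)
    · left; simpa using h
    · right
      have h2 : ‖ζ‖ = 1 := by simpa using hK hζ
      simp [h2, abs_of_pos hR]
  set S := (polynomialFunctions X).topologicalClosure with hS
  have hSc : IsClosed (S : Set C(X, ℂ)) := Subalgebra.isClosed_topologicalClosure _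
  let x : C(X, ℂ) := ContinuousMap.restrict X (.id ℂ)
  have hx : x ∈ S := Subalgebra.le_topologicalClosure _ ⟨Polynomial.X, Algebra.mem_top,
      Polynomial.toContinuousMapOn_X_eq_restrict_id X⟩
  -- The intermediate values of this ramp do not occur on `X`: it is the indicator of the outer
  -- piece.
  let e : C(X, ℂ) := ⟨fun z => ((max 0 ((‖(z : ℂ)‖ - s) / (R - s)) : ℝ) : ℂ), by fun_prop⟩
  have hRs : 0 < R - s := by linarith
  have e0 : ∀ z : X, ‖(z : ℂ)‖ ≤ s → e z = 0 := by
    intro z hz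
    have : (‖(z : ℂ)‖ - s) / (R - s) ≤ 0 := div_nonpos_of_nonpos_of_nonneg (by linarith) hRs.le
    simp [e, max_eq_left this]
  have e1 : ∀ z : X, ‖(z : ℂ)‖ = R → e z = 1 := by
    intro z hz
    simp [e, hz, div_self hRs.ne']
  have he : e ∈ S := mem_closure_polynomial_of_mul_pow hs hsR hX hXm 0 e e0
    (fun z hz => by simp [e1 z hz])
  have hee : e * e = e := by
    ext z
    rcases hXm z z.2 with hz | hz
    · simp [e0 z hz]
    · simp [e1 z hz]
  -- On the circle of radius `R`, `conj z = R² / z`, which is the case `k = 1`.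
  have hestar : e * star x ∈ S := by
    have h : ((R ^ 2 : ℝ)⁻¹ : ℂ) • (e * star x) ∈ S :=
      mem_closure_polynomial_of_mul_pow hs hsR hX hXm 1 _ (fun z hz => by simp [e0 z hz])
        (fun z hz => by
          have h3 : (starRingEnd ℂ) (z : ℂ) * z = ((R ^ 2 : ℝ) : ℂ) := by
            rw [mul_comm, Complex.mul_conj, Complex.normSq_eq_norm_sq, hz]
          have h4 : ((R ^ 2 : ℝ) : ℂ) ≠ 0 := by exact_mod_cast (by positivity : R ^ 2 ≠ 0)
          simp only [ContinuousMap.smul_apply, ContinuousMap.mul_apply, ContinuousMap.star_apply,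
            e1 z hz, one_mul, pow_one, smul_eq_mul]
          rw [mul_assoc]
          change _ * ((starRingEnd ℂ) (z : ℂ) * z) = 1
          rw [h3, inv_mul_cancel₀ h4])
    have h4 : ((R ^ 2 : ℝ) : ℂ) ≠ 0 := by exact_mod_cast (by positivity : R ^ 2 ≠ 0)
    have h5 := S.smul_mem h ((R ^ 2 : ℝ) : ℂ)
    rwa [smul_smul, mul_inv_cancel₀ h4, one_smul] at h5
  -- As `e` is idempotent, the `g` with `e * g ∈ S` form a closed subalgebra; it contains `z` and
  -- `conj z`, so Stone–Weierstrass applies.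
  have key : ∀ g : C(X, ℂ), e * g ∈ S := by
    intro g
    induction g using ContinuousMap.induction_on_of_compact with
    | const r =>
      have : e * ContinuousMap.const X r = r • e := by ext z; simp [mul_comm]
      rw [this]; exact S.smul_mem he r
    | id => exact S.mul_mem he hx
    | star_id => exact hestar
    | add f g hf hg => rw [mul_add]; exact S.add_mem hf hg
    | mul f g hf hg =>
      have : e * (f * g) = (e * f) * (e * g) := by
        rw [mul_mul_mul_comm, hee]
      rw [this]; exact S.mul_mem hf hg
    | frequently f hf =>
      have hcl : IsClosed {g : C(X, ℂ) | e * g ∈ S} := hSc.preimage (by fun_prop)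
      exact hcl.mem_of_frequently_of_tendsto hf tendsto_id
  let g : C(X, ℂ) := ⟨fun z => φ ((z : ℂ) / R), by fun_prop⟩
  have hg := key g
  rw [← SetLike.mem_coe, hS, Subalgebra.topologicalClosure_coe, Metric.mem_closure_iff] at hg
  obtain ⟨p, ⟨P, -, rfl⟩, hP⟩ := hg ε hε
  rw [dist_comm, ContinuousMap.dist_lt_iff hε] at hP
  refine ⟨P, fun z hz => ?_, fun ζ hζ => ?_⟩
  · have h := hP ⟨z, Or.inl (by simpa using hz)⟩
    rw [ContinuousMap.mul_apply, e0 _ hz, zero_mul, dist_zero_right] at h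
    exact h
  · have h2 : ‖ζ‖ = 1 := by simpa using hK hζ
    have h := hP ⟨(R : ℂ) * ζ, Or.inr ⟨ζ, hζ, rfl⟩⟩
    rw [ContinuousMap.mul_apply, e1 _ (by simp [h2, abs_of_pos hR]), one_mul, dist_eq_norm] at h
    simpa [g, hR0] using h

/-! ### Extension of targets and reformulation of universality. -/

theorem exists_continuous_eqOn {K : Set ℂ} (hK : IsClosed K) {φ : ℂ → ℂ} (hφ : ContinuousOn φ K) :
    ∃ ψ : C(ℂ, ℂ), Set.EqOn ψ φ K := by
  obtain ⟨ψ, hψ⟩ := ContinuousMap.exists_restrict_eq hK ⟨K.domRestrict φ, hφ.domRestrict⟩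
  exact ⟨ψ, fun z hz => congrArg (fun g : C(K, ℂ) => g ⟨z, hz⟩) hψ⟩

/-- Universality in terms of approximation by single dilates. -/
theorem mem_univWith_iff {r : ℕ → ℝ} {f : ℂ → ℂ} :
    f ∈ UnivWith r ↔ DifferentiableOn ℂ f (Metric.ball 0 1) ∧
      ∀ K : Set ℂ, K ⊆ Metric.sphere 0 1 → IsCompact K → K ≠ Metric.sphere 0 1 →
        ∀ φ : ℂ → ℂ, ContinuousOn φ K → ∀ ε > 0, ∀ N : ℕ,
          ∃ n ≥ N, ∀ ζ ∈ K, ‖f ((r n : ℂ) * ζ) - φ ζ‖ < ε := by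
  refine and_congr_right fun _ => ⟨fun h K hK hKc hK' φ hφ ε hε N => ?_,
    fun h K hK hKc hK' φ hφ => ?_⟩
  · obtain ⟨n, hn, hlim⟩ := h K hK hKc hK' φ hφ
    obtain ⟨k, hk, hkN⟩ := ((Metric.tendstoUniformlyOn_iff.mp hlim ε hε).and
      (eventually_ge_atTop N)).exists
    refine ⟨n k, hkN.trans (hn.id_le k), fun ζ hζ => ?_⟩
    rw [← dist_eq_norm, dist_comm]
    exact hk ζ hζ
  · obtain ⟨n, hn, hnk⟩ := extraction_forall_of_frequently
      (P := fun k n => ∀ ζ ∈ K, ‖f ((r n : ℂ) * ζ) - φ ζ‖ < 1 / ((k : ℝ) + 1))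
      (fun k => frequently_atTop.mpr fun N => h K hK hKc hK' φ hφ _ (by positivity) N)
    refine ⟨n, hn, Metric.tendstoUniformlyOn_iff.mpr fun ε hε => ?_⟩
    filter_upwards [tendsto_one_div_add_atTop_nhds_zero_nat.eventually (gt_mem_nhds hε)]
      with k hk ζ hζ
    rw [dist_comm, dist_eq_norm]
    exact (hnk k ζ hζ).trans hk

/-! ### Density of exponentials on proper parts of the circle. -/

/-- The continuous functions on `K` that have a continuous logarithm. -/
def expRange (K : Set ℂ) : Submonoid C(K, ℂ) where
  carrier := {u | ∃ g : C(K, ℂ), ∀ z, Complex.exp (g z) = u z}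
  one_mem' := ⟨0, fun z => by simp⟩
  mul_mem' := by
    rintro u v ⟨g, hg⟩ ⟨h, hh⟩
    exact ⟨g + h, fun z => by simp [Complex.exp_add, hg, hh]⟩

theorem mem_expRange_of_mem_slitPlane {K : Set ℂ} (u : C(K, ℂ))
    (hu : ∀ z, u z ∈ Complex.slitPlane) : u ∈ expRange K :=
  ⟨⟨fun z => Complex.log (u z), u.continuous.clog hu⟩, fun z =>
    Complex.exp_log (Complex.slitPlane_ne_zero (hu z))⟩

theorem const_mem_expRange {K : Set ℂ} {c : ℂ} (hc : c ≠ 0) :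
    ContinuousMap.const K c ∈ expRange K :=
  ⟨ContinuousMap.const K (Complex.log c), fun _ => Complex.exp_log hc⟩

theorem one_sub_mem_slitPlane {w : ℂ} (hw : ‖w‖ < 1) : 1 - w ∈ Complex.slitPlane := by
  refine Or.inl ?_
  have := Complex.re_le_norm w
  simp only [Complex.sub_re, Complex.one_re]
  linarith

/-- A linear factor whose root is off the unit circle has a continuous logarithm on a proper part
of the circle. -/
theorem sub_const_mem_expRange {K : Set ℂ} (hK : K ⊆ Metric.sphere 0 1)
    (hK' : K ≠ Metric.sphere 0 1) {a : ℂ} (ha : ‖a‖ ≠ 1) :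
    ContinuousMap.restrict K (.id ℂ) - ContinuousMap.const K a ∈ expRange K := by
  have hnorm : ∀ z : K, ‖(z : ℂ)‖ = 1 := fun z => by simpa using hK z.2
  have hne : ∀ z : K, (z : ℂ) ≠ 0 := fun z => by
    rw [← norm_pos_iff, hnorm]; exact one_pos
  rcases lt_or_gt_of_ne ha with h | h
  -- Factor `z - a = (-ζ₀) (-z/ζ₀) (1 - a/z)`. The middle factor is unimodular and misses `-1`
  -- because `ζ₀ ∉ K`, so the principal logarithm applies.
  · obtain ⟨ζ₀, hζ₀, hζ₀K⟩ := Set.exists_of_ssubset (hK.ssubset_of_ne hK')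
    have hζ₁ : ‖ζ₀‖ = 1 := by simpa using hζ₀
    have hζ₂ : ζ₀ ≠ 0 := by rw [← norm_pos_iff, hζ₁]; exact one_pos
    have h1 := const_mem_expRange (K := K) (neg_ne_zero.mpr hζ₂)
    have h2 : (⟨fun z : K => -(z : ℂ) / ζ₀, by fun_prop⟩ : C(K, ℂ)) ∈ expRange K := by
      refine mem_expRange_of_mem_slitPlane _ fun z => ?_
      by_contra hle
      rw [Complex.mem_slitPlane_iff, not_or, not_lt, not_not] at hle
      obtain ⟨hre, him⟩ : (-(z : ℂ) / ζ₀).re ≤ 0 ∧ (-(z : ℂ) / ζ₀).im = 0 := hle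
      have hn : ‖-(z : ℂ) / ζ₀‖ = 1 := by simp [hnorm, hζ₁]
      have hre1 : (-(z : ℂ) / ζ₀).re = -1 := by
        rw [← Complex.abs_re_eq_norm.mpr him, abs_of_nonpos hre] at hn
        linarith
      have h4 : -(z : ℂ) / ζ₀ = -1 := Complex.ext (by simpa using hre1) (by simpa using him)
      rw [div_eq_iff hζ₂] at h4
      have h5 : (z : ℂ) = ζ₀ := by linear_combination -h4
      exact hζ₀K (h5 ▸ z.2)
    have h3 : (⟨fun z : K => 1 - a / (z : ℂ), by fun_prop (disch := exact hne)⟩ : C(K, ℂ))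
        ∈ expRange K :=
      mem_expRange_of_mem_slitPlane _ fun z => one_sub_mem_slitPlane (by simpa [hnorm] using h)
    convert mul_mem (mul_mem h1 h2) h3 using 1
    ext z
    have := hne z
    simp only [ContinuousMap.sub_apply, ContinuousMap.restrict_apply, ContinuousMap.id_apply,
      ContinuousMap.const_apply, ContinuousMap.mul_apply, ContinuousMap.coe_mk]
    field_simp
  · have ha0 : a ≠ 0 := by rw [← norm_pos_iff]; linarith
    have h1 := const_mem_expRange (K := K) (neg_ne_zero.mpr ha0)
    have h3 : (⟨fun z : K => 1 - (z : ℂ) / a, by fun_prop⟩ : C(K, ℂ)) ∈ expRange K :=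
      mem_expRange_of_mem_slitPlane _ fun z => one_sub_mem_slitPlane (by
        rw [norm_div, hnorm, div_lt_one (by linarith)]; exact h)
    convert mul_mem h1 h3 using 1
    ext z
    simp only [ContinuousMap.sub_apply, ContinuousMap.restrict_apply, ContinuousMap.id_apply,
      ContinuousMap.const_apply, ContinuousMap.mul_apply, ContinuousMap.coe_mk]
    field_simp
    ring

theorem const_mem_closure_expRange {K : Set ℂ} [CompactSpace K] (c : ℂ) :
    ContinuousMap.const K c ∈ (expRange K).topologicalClosure := by
  have hd : c ∈ closure ({0}ᶜ : Set ℂ) := by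
    rw [(dense_compl_singleton (0 : ℂ)).closure_eq]; trivial
  have hcont : Continuous fun c : ℂ => ContinuousMap.const K c := ContinuousMap.continuous_const'
  exact map_mem_closure hcont hd fun b hb => const_mem_expRange hb

/-- A root on the circle is a limit of roots pushed radially outward. -/
theorem sub_const_mem_closure_expRange {K : Set ℂ} [CompactSpace K] (hK : K ⊆ Metric.sphere 0 1)
    (hK' : K ≠ Metric.sphere 0 1) (a : ℂ) :
    ContinuousMap.restrict K (.id ℂ) - ContinuousMap.const K a ∈
      (expRange K).topologicalClosure := by
  have hd : a ∈ closure ({b : ℂ | ‖b‖ ≠ 1}) := by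
    by_cases ha : ‖a‖ = 1
    · have hlim : Tendsto (fun n : ℕ => (1 + ((1 / ((n : ℝ) + 1) : ℝ) : ℂ)) * a) atTop (𝓝 a) := by
        have h1 := (Complex.continuous_ofReal.tendsto 0).comp
          tendsto_one_div_add_atTop_nhds_zero_nat
        simpa using (h1.const_add 1).mul_const a
      refine mem_closure_of_tendsto hlim (Eventually.of_forall fun n => ?_)
      have hpos : (0 : ℝ) < 1 / ((n : ℝ) + 1) := by positivity
      have h2 : ‖(1 + ((1 / ((n : ℝ) + 1) : ℝ) : ℂ)) * a‖ = 1 + 1 / ((n : ℝ) + 1) := by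
        rw [norm_mul, ha, mul_one, ← Complex.ofReal_one, ← Complex.ofReal_add, Complex.norm_real,
          Real.norm_eq_abs, abs_of_pos (by positivity)]
      change ‖_‖ ≠ 1
      rw [h2]
      linarith
    · exact subset_closure ha
  have hcont : Continuous fun c : ℂ =>
      ContinuousMap.restrict K (.id ℂ) - ContinuousMap.const K c :=
    continuous_const.sub ContinuousMap.continuous_const'
  exact map_mem_closure (f := fun c => ContinuousMap.restrict K (.id ℂ) - ContinuousMap.const K c)
    hcont hd fun b hb => sub_const_mem_expRange hK hK' hb

/-- Every continuous function on a proper compact part of the unit circle is uniformly approximable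
by exponentials of continuous functions. -/
theorem exists_exp_near {K : Set ℂ} (hK : K ⊆ Metric.sphere 0 1) (hKc : IsCompact K)
    (hK' : K ≠ Metric.sphere 0 1) {φ : ℂ → ℂ} (hφ : ContinuousOn φ K) {ε : ℝ} (hε : 0 < ε) :
    ∃ g : C(ℂ, ℂ), ∀ ζ ∈ K, ‖Complex.exp (g ζ) - φ ζ‖ < ε := by
  have : CompactSpace K := isCompact_iff_compactSpace.mp hKc
  obtain ⟨ψ, hψ⟩ := exists_continuous_eqOn hKc.isClosed hφ
  -- Only the approximation on `K` matters here; the inner radius `1 / 2` is arbitrary.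
  obtain ⟨P, -, hP⟩ := exists_polynomial_small_on_disc_near_on_arc (s := 1 / 2) (R := 1)
    (by norm_num) (by norm_num) hK hKc hK' ψ.continuous (half_pos hε)
  -- Split `P` into linear factors; the closure of a submonoid is again a submonoid.
  have hmem : P.toContinuousMapOnAlgHom K ∈ (expRange K).topologicalClosure := by
    rw [(IsAlgClosed.splits P).eq_prod_roots, map_mul, map_multiset_prod, Multiset.map_map]
    refine mul_mem ?_ (Submonoid.multiset_prod_mem _ _ fun u hu => ?_)
    · convert const_mem_closure_expRange (K := K) P.leadingCoeff using 1
      ext z; simp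
    · obtain ⟨a, -, rfl⟩ := Multiset.mem_map.mp hu
      convert sub_const_mem_closure_expRange hK hK' a using 1
      ext z; simp
  rw [← SetLike.mem_coe, Submonoid.coe_topologicalClosure, Metric.mem_closure_iff] at hmem
  obtain ⟨u, ⟨g, hg⟩, hu⟩ := hmem (ε / 2) (half_pos hε)
  obtain ⟨G, hG⟩ := ContinuousMap.exists_restrict_eq hKc.isClosed g
  refine ⟨G, fun ζ hζ => ?_⟩
  have h1 : G ζ = g ⟨ζ, hζ⟩ := congrArg (fun v : C(K, ℂ) => v ⟨ζ, hζ⟩) hG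
  rw [dist_comm, ContinuousMap.dist_lt_iff (half_pos hε)] at hu
  have h2 := hu ⟨ζ, hζ⟩
  rw [← hg, ← h1, dist_eq_norm] at h2
  have h3 := hP ζ hζ
  rw [hψ hζ, Complex.ofReal_one, one_mul] at h3
  have h4 : (P.toContinuousMapOnAlgHom K) ⟨ζ, hζ⟩ = P.eval ζ := by simp
  rw [h4] at h2
  calc ‖Complex.exp (G ζ) - φ ζ‖ ≤ ‖Complex.exp (G ζ) - P.eval ζ‖ + ‖P.eval ζ - φ ζ‖ :=
        norm_sub_le_norm_sub_add_norm_sub _ _ _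
    _ < ε := by linarith

/-! ### Stability under `e^f` and `α + 1/f`. -/

theorem exp_mem_univWith {r : ℕ → ℝ} {f : ℂ → ℂ} (hf : f ∈ UnivWith r) :
    (fun z => Complex.exp (f z)) ∈ UnivWith r := by
  rw [mem_univWith_iff] at hf ⊢
  refine ⟨hf.1.cexp, fun K hK hKc hK' φ hφ ε hε N => ?_⟩
  obtain ⟨g, hg⟩ := exists_exp_near hK hKc hK' hφ (half_pos hε)
  obtain ⟨C, hC⟩ := hKc.exists_bound_of_continuousOn (f := fun ζ => Complex.exp (g ζ))
    (by fun_prop)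
  have hM : 0 < |C| + 1 := by positivity
  -- The bound `1` allows `|e^w - 1| ≤ 2|w|` for `w = f - g`; the other bound then makes the error
  -- at most `ε/2`.
  obtain ⟨n, hn, hfn⟩ := hf.2 K hK hKc hK' g g.continuous.continuousOn
    (min 1 (ε / (4 * (|C| + 1)))) (by positivity) N
  refine ⟨n, hn, fun ζ hζ => ?_⟩
  have h1 := lt_min_iff.mp (hfn ζ hζ)
  have h2 : ‖Complex.exp (f (r n * ζ)) - Complex.exp (g ζ)‖ ≤ ε / 2 := by
    have : Complex.exp (f (r n * ζ)) - Complex.exp (g ζ) =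
        Complex.exp (g ζ) * (Complex.exp (f (r n * ζ) - g ζ) - 1) := by
      rw [mul_sub, ← Complex.exp_add, mul_one]; congr 2; ring
    rw [this, norm_mul]
    calc _ ≤ (|C| + 1) * (2 * (ε / (4 * (|C| + 1)))) := by
          gcongr
          · exact (hC ζ hζ).trans ((le_abs_self C).trans (by linarith))
          · refine (Complex.norm_exp_sub_one_le h1.1.le).trans ?_
            linarith [h1.2]
      _ = ε / 2 := by field_simp; ring
  calc ‖Complex.exp (f (r n * ζ)) - φ ζ‖
      ≤ ‖Complex.exp (f (r n * ζ)) - Complex.exp (g ζ)‖ + ‖Complex.exp (g ζ) - φ ζ‖ :=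
        norm_sub_le_norm_sub_add_norm_sub _ _ _
    _ < ε := by linarith [hg ζ hζ]

theorem const_add_inv_mem_univWith {r : ℕ → ℝ} {f : ℂ → ℂ} (hf : f ∈ UnivWith r)
    (hr : ∀ n, r n ∈ Set.Ico (0 : ℝ) 1) (hf0 : ZeroFree f) (α : ℂ) :
    (fun z => α + 1 / f z) ∈ UnivWith r := by
  rw [mem_univWith_iff] at hf ⊢
  refine ⟨(differentiableOn_const α).add ((differentiableOn_const 1).div hf.1 hf0),
    fun K hK hKc hK' φ hφ ε hε N => ?_⟩
  obtain ⟨g, hg⟩ := exists_exp_near hK hKc hK' (hφ.sub (continuousOn_const (c := α)))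
    (half_pos hε)
  obtain ⟨C, hC⟩ := hKc.exists_bound_of_continuousOn (f := fun ζ => Complex.exp (g ζ))
    (by fun_prop)
  obtain ⟨M, hMdef⟩ : ∃ M : ℝ, M = |C| + 1 := ⟨_, rfl⟩
  have hM : 0 < M := by rw [hMdef]; positivity
  -- Since `|e^{-g}| ≥ 1/M`, the first tolerance keeps `|f| ≥ 1/(2M)`; the second gives `|1/f - e^g|
  -- ≤ (ε/(4M²)) · M · 2M = ε/2`.
  obtain ⟨n, hn, hfn⟩ := hf.2 K hK hKc hK' (fun ζ => Complex.exp (-g ζ)) (by fun_prop)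
    (min (1 / (2 * M)) (ε / (4 * M ^ 2))) (by positivity) N
  refine ⟨n, hn, fun ζ hζ => ?_⟩
  have h1 := lt_min_iff.mp (hfn ζ hζ)
  have hexp : ‖Complex.exp (g ζ)‖ ≤ M :=
    (hC ζ hζ).trans ((le_abs_self C).trans (by linarith))
  have hexp0 : 0 < ‖Complex.exp (g ζ)‖ := norm_pos_iff.mpr (Complex.exp_ne_zero _)
  have hz : (r n : ℂ) * ζ ∈ Metric.ball (0 : ℂ) 1 := by
    have h2 : ‖ζ‖ = 1 := by simpa using hK hζ
    simp [h2, abs_of_nonneg (hr n).1, (hr n).2]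
  have hfz := hf0 _ hz
  have hlow : 1 / (2 * M) ≤ ‖f (r n * ζ)‖ := by
    have h3 : 1 / M ≤ ‖Complex.exp (-g ζ)‖ := by
      rw [Complex.exp_neg, norm_inv, one_div]
      gcongr
    have h4 := norm_sub_norm_le (Complex.exp (-g ζ)) (f (r n * ζ))
    rw [norm_sub_rev] at h4
    have h5 : 1 / M = 1 / (2 * M) + 1 / (2 * M) := by field_simp; norm_num
    linarith [h1.1]
  have h2 : ‖1 / f (r n * ζ) - Complex.exp (g ζ)‖ ≤ ε / 2 := by
    have h6 : 1 / f (r n * ζ) - Complex.exp (g ζ) =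
        -((f (r n * ζ) - Complex.exp (-g ζ)) * Complex.exp (g ζ)) / f (r n * ζ) := by
      rw [sub_mul, ← Complex.exp_add, neg_add_cancel, Complex.exp_zero]
      field_simp
      ring
    rw [h6, norm_div, norm_neg, norm_mul]
    calc _ ≤ (ε / (4 * M ^ 2)) * M / (1 / (2 * M)) := by
          gcongr
          exact h1.2.le
      _ = ε / 2 := by field_simp; norm_num
  calc ‖α + 1 / f (r n * ζ) - φ ζ‖
      = ‖(1 / f (r n * ζ) - Complex.exp (g ζ)) + (Complex.exp (g ζ) - (φ ζ - α))‖ := by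
        congr 1; ring
    _ ≤ _ := norm_add_le _ _
    _ < ε := by
      have h7 : ‖Complex.exp (g ζ) - (φ ζ - α)‖ < ε / 2 := hg ζ hζ
      linarith

/-! ### Existence of universal functions. -/

theorem exists_gt_radius {r : ℕ → ℝ} (hr : IsRadii r) {s : ℝ} (hs : s < 1) (N : ℕ) :
    ∃ n > N, s < r n :=
  (((eventually_gt_atTop N).and (hr.tendsto.eventually (lt_mem_nhds hs)))).exists

/-- Some holomorphic function on the disc approximates a prescribed sequence of continuous functions
on proper parts of suitable circles `‖z‖ = r n`. -/
theorem exists_holomorphic_near {r : ℕ → ℝ} (hr : IsRadii r) (K : ℕ → Set ℂ)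
    (hK : ∀ k, K k ⊆ Metric.sphere 0 1) (hKc : ∀ k, IsCompact (K k))
    (hK' : ∀ k, K k ≠ Metric.sphere 0 1) (Φ : ℕ → C(ℂ, ℂ)) :
    ∃ f : ℂ → ℂ, DifferentiableOn ℂ f (Metric.ball 0 1) ∧ ∃ n : ℕ → ℕ, StrictMono n ∧
      ∀ k, ∀ ζ ∈ K k, ‖f ((r (n k) : ℂ) * ζ) - Φ k ζ‖ ≤ 2 * (1 / 2 : ℝ) ^ k := by
  have hstep : ∀ (k : ℕ) (S : Polynomial ℂ × ℕ), ∃ T : Polynomial ℂ × ℕ, S.2 < T.2 ∧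
      (∀ z : ℂ, ‖z‖ ≤ r S.2 → dist (S.1.eval z) (T.1.eval z) ≤ (1 / 2 : ℝ) ^ k) ∧
      ∀ ζ ∈ K k, ‖T.1.eval ((r T.2 : ℂ) * ζ) - Φ k ζ‖ ≤ (1 / 2 : ℝ) ^ k := by
    rintro k ⟨Q, n⟩
    obtain ⟨m, hm, hrm⟩ := exists_gt_radius hr (hr.mem n).2 n
    have hn0 := (hr.mem n).1
    -- The midpoint of the radii is positive even when `r n = 0`. The target is what `Q` still lacks
    -- on the new circle.
    obtain ⟨P, hP1, hP2⟩ := exists_polynomial_small_on_disc_near_on_arc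
      (s := (r n + r m) / 2) (R := r m) (by linarith) (by linarith) (hK k) (hKc k) (hK' k)
      (φ := fun ζ => Φ k ζ - Q.eval ((r m : ℂ) * ζ)) (by fun_prop)
      (show (0 : ℝ) < (1 / 2) ^ k by positivity)
    refine ⟨(Q + P, m), hm, fun z hz => ?_, fun ζ hζ => ?_⟩
    · have hz' : ‖z‖ ≤ r n := hz
      simpa [dist_eq_norm] using (hP1 z (by linarith)).le
    · refine le_of_eq_of_le ?_ (hP2 ζ hζ).le
      rw [Polynomial.eval_add]
      congr 1
      ring
  choose F hF1 hF2 hF3 using hstep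
  let S : ℕ → Polynomial ℂ × ℕ := fun k => Nat.rec (0, 0) F k
  have hmono : StrictMono fun k => (S k).2 := strictMono_nat_of_lt_succ fun k => hF1 k (S k)
  have hmono' : Monotone fun k => r (S k).2 := hr.mono.comp hmono.monotone
  let f : ℂ → ℂ := fun z => limUnder atTop fun k => (S k).1.eval z
  have hbound : ∀ k, ∀ z : ℂ, ‖z‖ ≤ r (S k).2 →
      dist ((S k).1.eval z) (f z) ≤ 2 * (1 / 2 : ℝ) ^ k := by
    intro k z hz
    have hd : ∀ i, dist ((S (i + k)).1.eval z) ((S (i + 1 + k)).1.eval z) ≤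
        (1 / 2 : ℝ) ^ k * (1 / 2) ^ i := by
      intro i
      rw [← pow_add, add_right_comm, add_comm k]
      exact hF2 (i + k) (S (i + k)) z (hz.trans (hmono' (Nat.le_add_left k i)))
    obtain ⟨w, hw⟩ := cauchySeq_tendsto_of_complete
      (cauchySeq_of_le_geometric (1 / 2) _ (by norm_num) hd)
    have hfw : f z = w :=
      ((tendsto_add_atTop_iff_nat (f := fun k => (S k).1.eval z) k).mp hw).limUnder_eq
    have := dist_le_of_le_geometric_of_tendsto₀ (1 / 2) _ (by norm_num) hd hw
    rw [hfw]
    refine le_of_le_of_eq (by simpa only [zero_add] using this) ?_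
    ring
  have hr1 : ∀ s < 1, ∃ k, s < r (S k).2 := fun s hs =>
    ((hr.tendsto.comp hmono.tendsto_atTop).eventually (lt_mem_nhds hs)).exists
  have hpow : Tendsto (fun k : ℕ => 2 * (1 / 2 : ℝ) ^ k) atTop (𝓝 0) := by
    simpa using (tendsto_pow_atTop_nhds_zero_of_lt_one (by norm_num : (0 : ℝ) ≤ 1 / 2)
      (by norm_num)).const_mul 2
  -- The target `Φ k` is met at the radius chosen in passing from stage `k` to `k + 1`, hence the
  -- shift.
  refine ⟨f, ?_, fun k => (S (k + 1)).2, fun a b h => hmono (Nat.succ_lt_succ h), fun k ζ hζ => ?_⟩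
  · have hloc : TendstoLocallyUniformlyOn (fun k z => (S k).1.eval z) f atTop
        (Metric.ball (0 : ℂ) 1) := by
      rw [Metric.tendstoLocallyUniformlyOn_iff]
      intro ε hε z hz
      obtain ⟨k, hk⟩ := hr1 ‖z‖ (by simpa using hz)
      refine ⟨Metric.ball 0 (r (S k).2), mem_nhdsWithin_of_mem_nhds
        (Metric.isOpen_ball.mem_nhds (by simpa using hk)), ?_⟩
      filter_upwards [hpow.eventually (gt_mem_nhds hε), eventually_ge_atTop k] with j hj hkj y hy
      have hy' : ‖y‖ < r (S k).2 := by simpa using hy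
      rw [dist_comm]
      exact (hbound j y (hy'.le.trans (hmono' hkj))).trans_lt hj
    exact hloc.differentiableOn
      (Eventually.of_forall fun k => (Polynomial.differentiable _).differentiableOn)
      Metric.isOpen_ball
  · have h1 : ‖ζ‖ = 1 := by simpa using hK k hζ
    have h2 := hbound (k + 1) ((r (S (k + 1)).2 : ℂ) * ζ)
      (by simp [h1, abs_of_nonneg (hr.mem _).1])
    have h3 : ‖(S (k + 1)).1.eval ((r (S (k + 1)).2 : ℂ) * ζ) - Φ k ζ‖ ≤ (1 / 2 : ℝ) ^ k :=
      hF3 k (S k) ζ hζ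
    rw [dist_comm, dist_eq_norm] at h2
    calc _ ≤ _ := norm_sub_le_norm_sub_add_norm_sub _
          ((S (k + 1)).1.eval ((r (S (k + 1)).2 : ℂ) * ζ)) _
      _ ≤ 2 * (1 / 2 : ℝ) ^ (k + 1) + (1 / 2 : ℝ) ^ k := add_le_add h2 h3
      _ = 2 * (1 / 2 : ℝ) ^ k := by ring

/-- Countably many tasks suffice: circles with a small disc removed around a point of a dense
sequence, and targets from a dense sequence in `C(ℂ, ℂ)`. -/
theorem univWith_nonempty {r : ℕ → ℝ} (hr : IsRadii r) : (UnivWith r).Nonempty := by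
  have : Nonempty (Metric.sphere (0 : ℂ) 1) := ⟨⟨1, by simp⟩⟩
  let q : ℕ → ℂ := fun a => TopologicalSpace.denseSeq (Metric.sphere (0 : ℂ) 1) a
  have hq : ∀ a, q a ∈ Metric.sphere (0 : ℂ) 1 := fun a => Subtype.coe_prop _
  -- Using only the first unpaired coordinate makes every task recur infinitely often, with errors
  -- tending to `0`.
  let e : ℕ → ℕ × ℕ × ℕ := fun k => Denumerable.ofNat _ k.unpair.1
  have he : ∀ x N, ∃ k ≥ N, e k = x := fun x N =>
    ⟨Nat.pair (Encodable.encode x) N, Nat.right_le_pair _ _, by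
      simp only [e, Nat.unpair_pair]
      exact Denumerable.ofNat_encode x⟩
  let L : ℕ → Set ℂ := fun k =>
    Metric.sphere 0 1 \ Metric.ball (q (e k).1) (1 / (((e k).2.1 : ℝ) + 1))
  have hL : ∀ k, L k ⊆ Metric.sphere 0 1 := fun k => Set.sdiff_subset
  obtain ⟨f, hf, n, hn, hnf⟩ := exists_holomorphic_near hr L hL
    (fun k => (isCompact_sphere _ _).diff Metric.isOpen_ball)
    (fun k h => (h.symm ▸ hq (e k).1 : q (e k).1 ∈ L k).2
      (Metric.mem_ball_self (by positivity)))
    (fun k => TopologicalSpace.denseSeq C(ℂ, ℂ) (e k).2.2)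
  refine ⟨f, mem_univWith_iff.mpr ⟨hf, fun K hK hKc hK' φ hφ ε hε N => ?_⟩⟩
  obtain ⟨ζ₀, hζ₀, hζ₀K⟩ := Set.exists_of_ssubset (hK.ssubset_of_ne hK')
  obtain ⟨δ, hδ, hδK⟩ := Metric.mem_nhds_iff.mp (hKc.isClosed.isOpen_compl.mem_nhds hζ₀K)
  obtain ⟨m, hm⟩ := exists_nat_one_div_lt (half_pos hδ)
  obtain ⟨a, ha⟩ := (TopologicalSpace.denseRange_denseSeq (Metric.sphere (0 : ℂ) 1)).exists_dist_lt
    ⟨ζ₀, hζ₀⟩ (half_pos hδ)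
  obtain ⟨ψ, hψ⟩ := exists_continuous_eqOn hKc.isClosed hφ
  have hopen : {g : C(ℂ, ℂ) | ∀ z ∈ K, dist (ψ z) (g z) < ε / 2} ∈ 𝓝 ψ :=
    Metric.tendstoUniformlyOn_iff.mp
      (ContinuousMap.tendsto_iff_forall_isCompact_tendstoUniformlyOn.mp tendsto_id K hKc)
      (ε / 2) (half_pos hε)
  obtain ⟨_, hi, i, rfl⟩ := mem_closure_iff_nhds.mp
    (TopologicalSpace.denseRange_denseSeq C(ℂ, ℂ) ψ) _ hopen
  have hpow : Tendsto (fun k : ℕ => 2 * (1 / 2 : ℝ) ^ k) atTop (𝓝 0) := by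
    simpa using (tendsto_pow_atTop_nhds_zero_of_lt_one (by norm_num : (0 : ℝ) ≤ 1 / 2)
      (by norm_num)).const_mul 2
  obtain ⟨M, hM⟩ := eventually_atTop.mp (hpow.eventually (gt_mem_nhds (half_pos hε)))
  obtain ⟨k, hk, hke⟩ := he (a, m, i) (max M N)
  refine ⟨n k, (le_max_right M N).trans (hk.trans (hn.id_le k)), fun ζ hζ => ?_⟩
  have hζL : ζ ∈ L k := by
    refine ⟨hK hζ, fun hball => hδK (Metric.mem_ball.mpr ?_) hζ⟩
    simp only [hke, Metric.mem_ball] at hball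
    have ha' : dist ζ₀ (q a) < δ / 2 := ha
    calc dist ζ ζ₀ ≤ dist ζ (q a) + dist ζ₀ (q a) := dist_triangle_right _ _ _
      _ < δ := by linarith
  have h1 := hnf k ζ hζL
  have h2 := hM k ((le_max_left M N).trans hk)
  have h3 := hi ζ hζ
  rw [hψ hζ, dist_comm, dist_eq_norm] at h3
  rw [hke] at h1
  calc _ ≤ _ := norm_sub_le_norm_sub_add_norm_sub _ _ _
    _ < ε := by linarith

/-! ### Growth on components and a curve to infinity. -/

theorem isOpen_superlevel {f : ℂ → ℂ} (hf : DifferentiableOn ℂ f (Metric.ball 0 1)) (M : ℝ) :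
    IsOpen {z ∈ Metric.ball (0 : ℂ) 1 | M < ‖f z‖} :=
  hf.continuousOn.norm.isOpen_inter_preimage Metric.isOpen_ball isOpen_Ioi

theorem connectedComponentIn_eq_of_mem_closure {U : Set ℂ} (hU : IsOpen U) {w z : ℂ}
    (hz : z ∈ U) (hzD : z ∈ closure (connectedComponentIn U w)) :
    z ∈ connectedComponentIn U w := by
  obtain ⟨y, hy1, hy2⟩ := mem_closure_iff.mp hzD _ hU.connectedComponentIn
    (mem_connectedComponentIn hz)
  rw [connectedComponentIn_eq hy2, ← connectedComponentIn_eq hy1]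
  exact mem_connectedComponentIn hz

/-- An Abel universal function is unbounded on each component of each set `{M < ‖f‖}`. -/
theorem exists_lt_norm_of_component {r : ℕ → ℝ} (hr : IsRadii r) {f : ℂ → ℂ}
    (hf : f ∈ UnivWith r) {M : ℝ} (hM : 1 ≤ M) {w : ℂ}
    (hw : w ∈ {z ∈ Metric.ball (0 : ℂ) 1 | M < ‖f z‖}) (M' : ℝ) :
    ∃ z ∈ connectedComponentIn {z ∈ Metric.ball (0 : ℂ) 1 | M < ‖f z‖} w, M' < ‖f z‖ := by
  by_contra! hbdd
  rw [mem_univWith_iff] at hf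
  set U := {z ∈ Metric.ball (0 : ℂ) 1 | M < ‖f z‖} with hUdef
  set D := connectedComponentIn U w with hD
  have hU : IsOpen U := isOpen_superlevel hf.1 M
  have hDo : IsOpen D := hU.connectedComponentIn
  have hwD : w ∈ D := mem_connectedComponentIn hw
  have hDU : D ⊆ U := connectedComponentIn_subset _ _
  have hM'0 : 0 < M' := by linarith [hw.2, hbdd w hwD]
  have hw1 : ‖w‖ < 1 := by simpa using hw.1
  have hcont : ∀ z ∈ Metric.ball (0 : ℂ) 1, ContinuousAt f z := fun z hz =>
    hf.1.continuousOn.continuousAt (Metric.isOpen_ball.mem_nhds hz)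
  have hbddcl : ∀ z ∈ Metric.ball (0 : ℂ) 1, z ∈ closure D → ‖f z‖ ≤ M' := by
    intro z hz hzD
    by_contra! h
    obtain ⟨y, hy1, hy2⟩ := mem_closure_iff_nhds.mp hzD _
      ((hcont z hz).norm.eventually (lt_mem_nhds h))
    exact absurd (hbdd y hy2) (not_le.mpr hy1)
  -- Maximum principle for `f^N (z - 1)` on `D` cut at a radius where `|f| < 1` off a short arc near
  -- `1`. On that arc `|z - 1| ≤ 2δ` compensates for `|f| ≤ M'`; elsewhere on the frontier `|f| ≤
  -- M`. Letting `N → ∞` contradicts `|f w| > M`.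
  have key : ∀ N : ℕ, ‖f w‖ ^ N * ‖w - 1‖ ≤ 2 * M ^ N := by
    intro N
    refine le_of_forall_pos_le_add fun η hη => ?_
    -- Chosen so that `M'^N · 2δ = η`.
    set δ : ℝ := η / (2 * M' ^ N) with hδ
    have hδ0 : 0 < δ := by positivity
    obtain ⟨n₀, hn₀⟩ := eventually_atTop.mp
      ((hr.tendsto.eventually (lt_mem_nhds hw1)).and
        (hr.tendsto.eventually (lt_mem_nhds (show 1 - δ < 1 by linarith))))
    obtain ⟨n, hn, hfn⟩ := hf.2 (Metric.sphere 0 1 \ Metric.ball 1 δ) Set.sdiff_subset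
      ((isCompact_sphere _ _).diff Metric.isOpen_ball)
      (fun h => (h.symm ▸ (by simp : (1 : ℂ) ∈ Metric.sphere (0 : ℂ) 1) :
        (1 : ℂ) ∈ Metric.sphere (0 : ℂ) 1 \ Metric.ball 1 δ).2 (Metric.mem_ball_self hδ0))
      (fun _ => 0) continuousOn_const 1 one_pos n₀
    obtain ⟨hwr, hδr⟩ := hn₀ n hn
    have hr0 : 0 < r n := (norm_nonneg w).trans_lt hwr
    have hr1 : r n < 1 := (hr.mem n).2
    have hVcl : closure (D ∩ Metric.ball 0 (r n)) ⊆ Metric.closedBall 0 (r n) :=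
      closure_minimal (Set.inter_subset_right.trans Metric.ball_subset_closedBall)
        Metric.isClosed_closedBall
    have hcl1 : Metric.closedBall (0 : ℂ) (r n) ⊆ Metric.ball 0 1 :=
      Metric.closedBall_subset_ball hr1
    have hdiff : DiffContOnCl ℂ (fun z => f z ^ N * (z - 1)) (D ∩ Metric.ball 0 (r n)) := by
      have : DifferentiableOn ℂ (fun z => f z ^ N * (z - 1))
          (closure (D ∩ Metric.ball 0 (r n))) :=
        ((hf.1.mono (hVcl.trans hcl1)).pow N).mul (by fun_prop)
      exact this.diffContOnCl
    have hmax := Complex.norm_le_of_forall_mem_frontier_norm_le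
      (Metric.isBounded_ball.subset Set.inter_subset_right) hdiff (C := 2 * M ^ N + η) ?_
      (subset_closure ⟨hwD, by simpa using hwr⟩)
    · simpa using hmax
    intro z hz
    have hzr : ‖z‖ ≤ r n := by simpa using hVcl hz.1
    have hz1 : z ∈ Metric.ball (0 : ℂ) 1 := hcl1 (hVcl hz.1)
    have hzD : z ∈ closure D := closure_mono Set.inter_subset_left hz.1
    have hsub2 : ‖z - 1‖ ≤ 2 := by
      have := norm_sub_le z 1
      rw [norm_one] at this
      linarith
    have hsmall : ‖f z‖ ≤ M → ‖f z ^ N * (z - 1)‖ ≤ 2 * M ^ N + η := by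
      intro h
      rw [norm_mul, norm_pow]
      have : ‖f z‖ ^ N * ‖z - 1‖ ≤ M ^ N * 2 := by gcongr
      linarith
    rcases hzr.lt_or_eq with hlt | heq
    · refine hsmall (le_of_not_gt fun h => ?_)
      have hzV : z ∈ D ∩ Metric.ball 0 (r n) :=
        ⟨connectedComponentIn_eq_of_mem_closure hU ⟨hz1, h⟩ hzD, by simpa using hlt⟩
      exact hz.2 ((hDo.inter Metric.isOpen_ball).interior_eq.symm ▸ hzV)
    · have hrc : (r n : ℂ) ≠ 0 := by exact_mod_cast hr0.ne'
      have hζ : (r n : ℂ) * (z / r n) = z := by field_simp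
      have hζ1 : ‖z / r n‖ = 1 := by
        rw [norm_div, heq, Complex.norm_real, Real.norm_eq_abs, abs_of_pos hr0, div_self hr0.ne']
      by_cases hball : z / r n ∈ Metric.ball (1 : ℂ) δ
      · have h1 : ‖z / r n - 1‖ < δ := by simpa [dist_eq_norm] using hball
        have h2 : ‖z - z / r n‖ = 1 - r n := by
          have : z - z / r n = ((r n - 1 : ℝ) : ℂ) * (z / r n) := by
            push_cast; field_simp
          rw [this, norm_mul, hζ1, mul_one, Complex.norm_real, Real.norm_eq_abs,
            abs_of_neg (by linarith)]
          ring
        have h3 : ‖z - 1‖ ≤ 2 * δ := by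
          have := norm_sub_le_norm_sub_add_norm_sub z (z / r n) 1
          linarith
        rw [norm_mul, norm_pow]
        calc ‖f z‖ ^ N * ‖z - 1‖ ≤ M' ^ N * (2 * δ) := by
              gcongr
              exact hbddcl z hz1 hzD
          _ = η := by rw [hδ]; field_simp
          _ ≤ 2 * M ^ N + η := by
              have : 0 < M ^ N := by positivity
              linarith
      · have h1 := hfn (z / r n) ⟨by simpa using hζ1, hball⟩
        rw [hζ, sub_zero] at h1
        exact hsmall (h1.le.trans hM)
  have hM0 : 0 < M := by linarith
  have hq : 1 < ‖f w‖ / M := (one_lt_div hM0).mpr hw.2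
  have hw10 : 0 < ‖w - 1‖ := by
    rw [norm_pos_iff, sub_ne_zero]
    rintro rfl
    simp at hw1
  obtain ⟨N, hN⟩ := ((tendsto_pow_atTop_atTop_of_one_lt hq).eventually
    (eventually_gt_atTop (2 / ‖w - 1‖))).exists
  rw [div_lt_iff₀ hw10, div_pow, div_mul_eq_mul_div, lt_div_iff₀ (by positivity)] at hN
  exact absurd (key N) (not_le.mpr hN)

/-- Concatenation of infinitely many paths. -/
theorem exists_continuous_concat {X : Type*} [TopologicalSpace X] {z : ℕ → X}
    (p : ∀ n, Path (z n) (z (n + 1))) :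
    ∃ Γ : ℝ → X, Continuous Γ ∧ ∀ s, 0 ≤ s → Γ s ∈ Set.range (p ⌊s⌋₊) := by
  let Γ : ℝ → X := fun s => (p ⌊s⌋₊).extend (s - ⌊s⌋₊)
  have hfloor : ∀ (n : ℕ) (s : ℝ), ⌊s⌋₊ = n → Γ s = (p n).extend (s - n) := by
    rintro _ s rfl
    rfl
  have hcell : ∀ n : ℕ, ContinuousOn Γ (Set.Icc n (n + 1)) := by
    intro n
    have hc : Continuous fun s : ℝ => (p n).extend (s - n) :=
      (p n).continuous_extend.comp (by fun_prop)
    refine hc.continuousOn.congr fun s hs => ?_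
    rcases hs.2.lt_or_eq with h | rfl
    · have : ⌊s⌋₊ = n := (Nat.floor_eq_iff ((Nat.cast_nonneg n).trans hs.1)).mpr ⟨hs.1, h⟩
      exact hfloor n s this
    -- At the right endpoint the floor has already jumped; the next path starts where this one ends.
    · have : ⌊(n : ℝ) + 1⌋₊ = n + 1 := by exact_mod_cast Nat.floor_natCast (n + 1)
      simp [hfloor _ _ this]
  have hIic : ∀ n : ℕ, ContinuousOn Γ (Set.Iic (n : ℝ)) := by
    intro n
    induction n with
    | zero =>
      refine (continuousOn_const (c := z 0)).congr fun s hs => ?_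
      have hs0 : s ≤ 0 := by simpa using hs
      simp [hfloor 0 s (Nat.floor_of_nonpos hs0), (p 0).extend_of_le_zero hs0]
    | succ n ih =>
      have hU : Set.Iic ((n + 1 : ℕ) : ℝ) = Set.Iic (n : ℝ) ∪ Set.Icc (n : ℝ) (n + 1) := by
        rw [Set.Iic_union_Icc_eq_Iic (by linarith)]
        push_cast
        rfl
      rw [hU]
      exact ih.union_of_isClosed (hcell n) isClosed_Iic isClosed_Icc
  refine ⟨Γ, continuous_iff_continuousAt.mpr fun s => ?_, fun s hs => ?_⟩
  · obtain ⟨n, hn⟩ := exists_nat_gt s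
    exact (hIic n).continuousAt (Iic_mem_nhds hn)
  · rw [← Path.extend_range]
    exact Set.mem_range_self _

/-- An Abel universal function tends to infinity along some curve in the disc. -/
theorem exists_curve_norm_gt {r : ℕ → ℝ} (hr : IsRadii r) {f : ℂ → ℂ} (hf : f ∈ UnivWith r) :
    ∃ Γ : ℝ → ℂ, Continuous Γ ∧ ∀ s, 0 ≤ s → Γ s ∈ Metric.ball 0 1 ∧ s < ‖f (Γ s)‖ := by
  -- The shift by `1` gives levels at least `1` and turns `s < ⌊s⌋₊ + 1` into `s < |f (Γ s)|`.
  let U : ℕ → Set ℂ := fun n => {z ∈ Metric.ball (0 : ℂ) 1 | (n : ℝ) + 1 < ‖f z‖}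
  have hstep : ∀ (n : ℕ) (z : U n), ∃ z' : U (n + 1), JoinedIn (U n) (z : ℂ) (z' : ℂ) := by
    rintro n ⟨z, hz⟩
    have hopen : IsOpen (U n) := isOpen_superlevel hf.1 _
    obtain ⟨z', hz', hfz'⟩ := exists_lt_norm_of_component hr hf
      (le_add_of_nonneg_left (Nat.cast_nonneg n)) hz ((n : ℝ) + 1 + 1)
    have hsub := connectedComponentIn_subset (U n) z
    refine ⟨⟨z', (hsub hz').1, by push_cast; exact hfz'⟩, ?_⟩
    have hpc : IsPathConnected (connectedComponentIn (U n) z) :=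
      hopen.connectedComponentIn.isConnected_iff_isPathConnected.mp
        (isConnected_connectedComponentIn_iff.mpr hz)
    exact (hpc.joinedIn z (mem_connectedComponentIn hz) z' hz').mono hsub
  choose F hF using hstep
  obtain ⟨z₀, hz₀⟩ : (U 0).Nonempty := by
    have hsub : ({1} : Set ℂ) ⊆ Metric.sphere 0 1 := by simp
    have hne : ({1} : Set ℂ) ≠ Metric.sphere 0 1 := by
      intro h
      have : (-1 : ℂ) ∈ ({1} : Set ℂ) := by rw [h]; simp
      norm_num at this
    obtain ⟨n, -, hn⟩ := (mem_univWith_iff.mp hf).2 {1} hsub isCompact_singleton hne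
      (fun _ => 3) continuousOn_const 1 one_pos 0
    have h1 := hn 1 rfl
    rw [mul_one] at h1
    refine ⟨(r n : ℂ), ?_, ?_⟩
    · simpa [abs_of_nonneg (hr.mem n).1] using (hr.mem n).2
    · have h2 := norm_sub_norm_le (3 : ℂ) (f (r n))
      rw [norm_sub_rev] at h2
      have h3 : ‖(3 : ℂ)‖ = 3 := by simp
      push_cast
      linarith
  let z : ∀ n, U n := fun n => Nat.rec (motive := fun n => U n) ⟨z₀, hz₀⟩ F n
  have hz : ∀ n, JoinedIn (U n) (z n).1 (z (n + 1)).1 := fun n => hF n (z n)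
  obtain ⟨Γ, hΓ, hΓr⟩ := exists_continuous_concat fun n => (hz n).somePath
  refine ⟨Γ, hΓ, fun s hs => ?_⟩
  obtain ⟨t, ht⟩ := hΓr s hs
  have hmem : Γ s ∈ U ⌊s⌋₊ := ht ▸ (hz ⌊s⌋₊).somePath_mem t
  exact ⟨hmem.1, (Nat.lt_floor_add_one s).trans hmem.2⟩

theorem hasAsymptoticValue_const_add_inv {r : ℕ → ℝ} (hr : IsRadii r) {f : ℂ → ℂ}
    (hf : f ∈ UnivWith r) (α : ℂ) : HasAsymptoticValue (fun z => α + 1 / f z) α := by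
  obtain ⟨Γ, hΓ, hΓf⟩ := exists_curve_norm_gt hr hf
  have hsub : Tendsto (fun t : ℝ => 1 - t) (𝓝[<] 1) (𝓝[>] 0) := by
    refine tendsto_nhdsWithin_iff.mpr ⟨?_, ?_⟩
    · have : Continuous fun t : ℝ => 1 - t := by fun_prop
      simpa using (this.tendsto 1).mono_left nhdsWithin_le_nhds
    · filter_upwards [self_mem_nhdsWithin] with t ht
      simpa using ht
  have hlim : Tendsto (fun t : ℝ => t / (1 - t)) (𝓝[<] 1) atTop := by
    have h1 : Tendsto (fun t : ℝ => t) (𝓝[<] 1) (𝓝 1) := tendsto_id.mono_left nhdsWithin_le_nhds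
    exact h1.pos_mul_atTop one_pos (tendsto_inv_nhdsGT_zero.comp hsub)
  have hnonneg : ∀ t ∈ Set.Ico (0 : ℝ) 1, 0 ≤ t / (1 - t) := fun t ht =>
    div_nonneg ht.1 (by linarith [ht.2])
  have hnorm : Tendsto (fun s => ‖f (Γ s)‖) atTop atTop :=
    tendsto_atTop_mono' _ ((eventually_ge_atTop 0).mono fun s hs => (hΓf s hs).2.le) tendsto_id
  refine ⟨fun t => Γ (t / (1 - t)), ?_, fun t ht => (hΓf _ (hnonneg t ht)).1, ?_, ?_⟩
  · refine hΓ.comp_continuousOn (continuousOn_id.div (by fun_prop) fun t ht => ?_)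
    linarith [ht.2]
  -- As `f` is bounded on each smaller closed disc, the curve must eventually leave it.
  · have h1 : Tendsto (fun s => ‖Γ s‖) atTop (𝓝 1) := by
      refine tendsto_order.mpr ⟨fun c hc => ?_, fun c hc => ?_⟩
      · obtain ⟨B, hB⟩ := (isCompact_closedBall (0 : ℂ) c).exists_bound_of_continuousOn
          (hf.1.continuousOn.mono (Metric.closedBall_subset_ball hc))
        filter_upwards [hnorm.eventually (eventually_gt_atTop B)] with s hs
        by_contra! h
        exact absurd (hB (Γ s) (by simpa using h)) (not_le.mpr hs)
      · filter_upwards [eventually_ge_atTop 0] with s hs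
        have : ‖Γ s‖ < 1 := by simpa using (hΓf s hs).1
        linarith
    exact h1.comp hlim
  · have h1 : Tendsto (fun s => (f (Γ s))⁻¹) atTop (𝓝 0) :=
      tendsto_inv₀_cobounded.comp (tendsto_norm_atTop_iff_cobounded.mp hnorm)
    simpa using (h1.comp hlim).const_add α

/-! ### Assembly for fixed radii and for the union. -/

theorem exists_zeroFree_mem_univWith {r : ℕ → ℝ} (hr : IsRadii r) :
    ∃ g ∈ UnivWith r, ZeroFree g := by
  obtain ⟨f, hf⟩ := univWith_nonempty hr
  exact ⟨_, exp_mem_univWith hf, fun z _ => Complex.exp_ne_zero _⟩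

theorem exists_hasAsymptoticValue_mem_univWith {r : ℕ → ℝ} (hr : IsRadii r) (α : ℂ) :
    ∃ g ∈ UnivWith r, HasAsymptoticValue g α := by
  obtain ⟨f, hf, hf0⟩ := exists_zeroFree_mem_univWith hr
  exact ⟨_, const_add_inv_mem_univWith hf hr.mem hf0 α, hasAsymptoticValue_const_add_inv hr hf α⟩

theorem exists_isRadii : ∃ r : ℕ → ℝ, IsRadii r := by
  refine ⟨fun n => 1 - 1 / ((n : ℝ) + 1), fun n => ⟨?_, ?_⟩, fun a b h => ?_, ?_⟩
  · rw [sub_nonneg, div_le_one (by positivity)]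
    linarith [(Nat.cast_nonneg n : (0 : ℝ) ≤ n)]
  · have : (0 : ℝ) < 1 / ((n : ℝ) + 1) := by positivity
    linarith
  · exact sub_le_sub_left (Nat.one_div_le_one_div h) 1
  · simpa using tendsto_one_div_add_atTop_nhds_zero_nat.const_sub (1 : ℝ)

end AbelUniv

theorem mainTheorem6 :
    (∀ r : ℕ → ℝ, AbelUniv.IsRadii r →
      (∀ f ∈ AbelUniv.UnivWith r, (fun z => Complex.exp (f z)) ∈ AbelUniv.UnivWith r) ∧
      (∃ g ∈ AbelUniv.UnivWith r, AbelUniv.ZeroFree g) ∧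
      (∀ f ∈ AbelUniv.UnivWith r, AbelUniv.ZeroFree f →
        ∀ α : ℂ, (fun z => α + 1 / f z) ∈ AbelUniv.UnivWith r) ∧
      (∀ α : ℂ, ∃ g ∈ AbelUniv.UnivWith r, AbelUniv.HasAsymptoticValue g α)) ∧
    (∀ f ∈ AbelUniv.Univ, (fun z => Complex.exp (f z)) ∈ AbelUniv.Univ) ∧
    (∃ g ∈ AbelUniv.Univ, AbelUniv.ZeroFree g) ∧
    (∀ f ∈ AbelUniv.Univ, AbelUniv.ZeroFree f →
      ∀ α : ℂ, (fun z => α + 1 / f z) ∈ AbelUniv.Univ) ∧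
    (∀ α : ℂ, ∃ g ∈ AbelUniv.Univ, AbelUniv.HasAsymptoticValue g α) := by
  obtain ⟨r, hr⟩ := AbelUniv.exists_isRadii
  refine ⟨fun r hr => ⟨fun f hf => AbelUniv.exp_mem_univWith hf,
    AbelUniv.exists_zeroFree_mem_univWith hr,
    fun f hf hf0 α => AbelUniv.const_add_inv_mem_univWith hf hr.mem hf0 α,
    AbelUniv.exists_hasAsymptoticValue_mem_univWith hr⟩, ?_, ?_, ?_, fun α => ?_⟩
  · rintro f ⟨ρ, hρ, hf⟩
    exact ⟨ρ, hρ, AbelUniv.exp_mem_univWith hf⟩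
  · obtain ⟨g, hg, hg0⟩ := AbelUniv.exists_zeroFree_mem_univWith hr
    exact ⟨g, ⟨r, hr, hg⟩, hg0⟩
  · rintro f ⟨ρ, hρ, hf⟩ hf0 α
    exact ⟨ρ, hρ, AbelUniv.const_add_inv_mem_univWith hf hρ.mem hf0 α⟩
  · obtain ⟨g, hg, hgα⟩ := AbelUniv.exists_hasAsymptoticValue_mem_univWith hr α
    exact ⟨g, ⟨r, hr, hg⟩, hgα⟩
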